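/- Conventions. A compact quantum metric space $(\mathfrak A,\mathsf L)$ is a unital C*-algebra with a seminorm $\mathsf L:\mathfrak{sa}(\mathfrak A)\to[0,\infty]$ that is lower semicontinuous for the C*-norm, has dense domain $\{\mathsf L<\infty\}$ and kernel $\mathbb R1_{\mathfrak A}$, and whose Monge-Kantorovich metric $\mathsf{mk}_{\mathsf L}(\varphi,\psi)=\sup\{|\varphi(a)-\psi(a)|:\mathsf L(a)\le1\}$ metrizes the weak* topology of the state space $\mathscr S(\mathfrak A)$; then $\mathsf L$ is called a Lip-norm. It is $(C,D)$-quasi-Leibniz ($C\ge1$, $D\ge0$) if for all $a,b$ in its domain both $\mathsf L\left(\frac{ab+ba}{2}\right)$ and $\mathsf L\left(\frac{ab-ba}{2i}\right)$ are at most $C(\|a\|\mathsf L(b)+\|b\|\mathsf L(a))+D\,\mathsf L(a)\mathsf L(b)$, and quasi-Leibniz if this holds for some such $C,D$. A bridge $\gamma=(\mathfrak D,\omega,\pi_{\mathfrak A},\pi_{\mathfrak B})$ from $\mathfrak A$ to $\mathfrak B$ consists of a unital C*-algebra $\mathfrak D$, an element $\omega\in\mathfrak D$ for which the set $\mathscr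 S_1(\mathfrak D|\omega)$ of the states $\varphi$ of $\mathfrak D$ with $\varphi((1-\omega)^*(1-\omega))=\varphi((1-\omega)(1-\omega)^*)=0$ is not empty, and unital injective *-homomorphisms $\pi_{\mathfrak A}:\mathfrak A\to\mathfrak D$, $\pi_{\mathfrak B}:\mathfrak B\to\mathfrak D$. Its length with respect to $\mathsf L_{\mathfrak A},\mathsf L_{\mathfrak B}$ is the maximum of the Hausdorff distance in $\mathfrak D$ between $\{\pi_{\mathfrak A}(a)\omega:\mathsf L_{\mathfrak A}(a)\le1\}$ and $\{\omega\pi_{\mathfrak B}(b):\mathsf L_{\mathfrak B}(b)\le1\}$, and of the Hausdorff distances between $\mathscr S(\mathfrak A)$ and $\{\varphi\circ\pi_{\mathfrak A}:\varphi\in\mathscr S_1(\mathfrak D|\omega)\}$ for $\mathsf{mk}_{\mathsf L_{\mathfrak A}}$ and between $\mathscr S(\mathfrak B)$ and $\{\varphi\circ\pi_{\mathfrak B}:\varphi\in\mathscr S_1(\mathfrak D|\omega)\}$ for $\mathsf{mk}_{\mathsf L_{\mathfrak B}}$. The quantum Gromov-Hausdorff propinquity $\mathsf\Lambda$ of two quasi-Leibniz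 compact quantum metric spaces is the infimum, over all finite chains of bridges through quasi-Leibniz compact quantum metric spaces that join them, of the sum of the lengths of the bridges. Let $\mathfrak A=\bigoplus_{l=0}^nM_{m_l}(\mathbb C)$ with $n\in\mathbb N$, $m_l\in\mathbb N\setminus\{0\}$, and let $m_{\mathfrak A}=\max_lm_l$. For $a=(a^l_{j,k})\in\mathfrak{sa}(\mathfrak A)$ let $\|a\|_{\infty,\mathfrak A_{\mathbb R}}=\max_{l,j,k}\max\{|\mathrm{Re}\,a^l_{j,k}|,|\mathrm{Im}\,a^l_{j,k}|\}$. For a nonempty compact metric space $(Y,\mathsf d)$ and $a\in\mathfrak{sa}(C(Y,\mathfrak A))$ let $$\mathsf L_{Y}(a)=\max\left\{\sup_{x\ne y}\frac{\|a(x)-a(y)\|_{\infty,\mathfrak A_{\mathbb R}}}{\mathsf d(x,y)},\ \inf_{r\in\mathbb R}\sup_{x\in Y}\|a(x)-r1_{\mathfrak A}\|_{\infty,\mathfrak A_{\mathbb R}}\right\}.$$ Corollary. For every nonempty compact metric space $(X,\mathsf d_X)$ there is a sequence $(X_k)_{k\in\mathbb N}$ of nonempty finite subsets of $X$, with the metric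 of $X$, such that $$\lim_{k\to\infty}\mathsf\Lambda\big((C(X_k,\mathfrak A),\mathsf L_{X_k}),(C(X,\mathfrak A),\mathsf L_X)\big)=0.$$ Moreover every $C(X_k,\mathfrak A)$ is finite-dimensional, and all the $\mathsf L_{X_k}$ as well as $\mathsf L_X$ are $(\sqrt2\,m_{\mathfrak A},0)$-quasi-Leibniz Lip-norms; so $C(X,\mathfrak A)$ with a $(\sqrt2\,m_{\mathfrak A},0)$-quasi-Leibniz Lip-norm is a limit in propinquity of finite-dimensional C*-algebras with $(\sqrt2\,m_{\mathfrak A},0)$-quasi-Leibniz Lip-norms. -/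

import Mathlib

open Filter Topology
open scoped ENNReal NNReal ComplexOrder Matrix.Norms.L2Operator

universe u

noncomputable section

namespace QuantumMetric

section LipNorms

variable {A : Type u} [CStarAlgebra A]

/-- The states of a unital C*-algebra: positive linear functionals of value `1` at the unit.
The subtype topology inherited from `WeakDual` is the weak* topology. -/
def StateSpace (A : Type u) [CStarAlgebra A] : Set (WeakDual ℂ A) :=
  {φ | φ 1 = 1 ∧ ∀ a : A, 0 ≤ φ (star a * a)}

/-- The Monge-Kantorovich (extended) distance between two states. -/
def mkDist (L : selfAdjoint A → ℝ≥0∞) (φ ψ : StateSpace A) : ℝ≥0∞ :=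
  ⨆ (a : selfAdjoint A) (_ : L a ≤ 1), ‖φ.1 (a : A) - ψ.1 (a : A)‖ₑ

/-- The Jordan product `(ab + ba) / 2`. -/
def jordan (a b : selfAdjoint A) : selfAdjoint A :=
  ⟨(2 : ℂ)⁻¹ • ((a : A) * b + b * a), by
    rw [selfAdjoint.mem_iff]
    simp [star_smul, selfAdjoint.star_val_eq, add_comm]⟩

/-- The Lie product `(ab - ba) / (2i)`. -/
def lie (a b : selfAdjoint A) : selfAdjoint A :=
  ⟨(2 * Complex.I)⁻¹ • ((a : A) * b - b * a), by
    rw [selfAdjoint.mem_iff]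
    simp [star_smul, selfAdjoint.star_val_eq, smul_sub, add_comm]⟩

/-- `L` is a Lip-norm, i.e. `(A, L)` is a compact quantum metric space. The value `∞` is allowed
for `L`, and `0 * ∞ = 0` in `ℝ≥0∞`. -/
structure IsLipNorm (L : selfAdjoint A → ℝ≥0∞) : Prop where
  add_le : ∀ a b, L (a + b) ≤ L a + L b
  smul : ∀ (t : ℝ) (a), L (t • a) = ‖t‖ₑ * L a
  dense_dom : Dense {a | L a < ∞}
  eq_zero_iff : ∀ a, L a = 0 ↔ ∃ t : ℝ, a = t • (1 : selfAdjoint A)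
  mkDist_ne_top : ∀ φ ψ : StateSpace A, mkDist L φ ψ ≠ ∞
  /-- the metric `mkDist L` induces the weak* topology on the state space -/
  nhds_basis : ∀ φ : StateSpace A,
    (𝓝 φ).HasBasis (fun ε : ℝ≥0∞ => 0 < ε) (fun ε => {ψ | mkDist L φ ψ < ε})
  lsc : LowerSemicontinuous L

/-- `L` is a `(C, D)`-quasi-Leibniz Lip-norm. -/
structure IsQuasiLeibnizLipNorm (C D : ℝ) (L : selfAdjoint A → ℝ≥0∞) : Prop
    extends IsLipNorm L where
  one_le : 1 ≤ C
  nonneg : 0 ≤ D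
  leibniz : ∀ a b, L a < ∞ → L b < ∞ →
    max (L (jordan a b)) (L (lie a b)) ≤
      ENNReal.ofReal C * (‖(a : A)‖ₑ * L b + ‖(b : A)‖ₑ * L a) + ENNReal.ofReal D * L a * L b

end LipNorms

section Propinquity

/-- A unital C*-algebra with a `[0, ∞]`-valued function on its self-adjoint part. -/
structure LipPair : Type (u + 1) where
  carrier : Type u
  [cstar : CStarAlgebra carrier]
  lip : selfAdjoint carrier → ℝ≥0∞

attribute [instance] LipPair.cstar

/-- The pair is a quasi-Leibniz compact quantum metric space. -/
def LipPair.IsQuasiLeibniz (P : LipPair.{u}) : Prop :=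
  ∃ C D : ℝ, IsQuasiLeibnizLipNorm C D P.lip

/-- The set of self-adjoint elements of Lip-norm at most `1`. -/
def LipPair.lipBall (P : LipPair.{u}) : Set P.carrier :=
  {a | ∃ b : selfAdjoint P.carrier, P.lip b ≤ 1 ∧ (b : P.carrier) = a}

/-- The `1`-level set of an element of a unital C*-algebra. -/
def levelOne {D : Type u} [CStarAlgebra D] (ω : D) : Set (StateSpace D) :=
  {φ | φ.1 (star (1 - ω) * (1 - ω)) = 0 ∧ φ.1 ((1 - ω) * star (1 - ω)) = 0}

/-- A bridge between two unital C*-algebras. -/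
structure Bridge (A B : Type u) [CStarAlgebra A] [CStarAlgebra B] : Type (u + 1) where
  space : Type u
  [cstar : CStarAlgebra space]
  pivot : space
  levelOne_nonempty : (levelOne pivot).Nonempty
  left : A →⋆ₐ[ℂ] space
  right : B →⋆ₐ[ℂ] space
  left_injective : Function.Injective left
  right_injective : Function.Injective right

attribute [instance] Bridge.cstar

/-- The set of states of `A` that are pullbacks under `π` of states in `K`. -/
def pullbackStates {A D : Type u} [CStarAlgebra A] [CStarAlgebra D] (π : A →⋆ₐ[ℂ] D)
    (K : Set (StateSpace D)) : Set (StateSpace A) :=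
  {ψ | ∃ φ ∈ K, ∀ a : A, ψ.1 a = φ.1 (π a)}

/-- The Hausdorff (extended) distance between two sets with respect to a distance function. -/
def hausdorffOf {S : Type*} (d : S → S → ℝ≥0∞) (s t : Set S) : ℝ≥0∞ :=
  max (⨆ x ∈ s, ⨅ y ∈ t, d x y) (⨆ y ∈ t, ⨅ x ∈ s, d x y)

variable {P Q : LipPair.{u}}

/-- The reach of a bridge: the Hausdorff distance, in the C*-norm, between the sets
`π_A(a) ω` and `ω π_B(b)` for `a`, `b` in the two Lip-balls. -/
def Bridge.reach (γ : Bridge P.carrier Q.carrier) : ℝ≥0∞ :=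
  Metric.hausdorffEDist ((fun a => γ.left a * γ.pivot) '' P.lipBall)
    ((fun b => γ.pivot * γ.right b) '' Q.lipBall)

/-- The height of a bridge. -/
def Bridge.height (γ : Bridge P.carrier Q.carrier) : ℝ≥0∞ :=
  max (hausdorffOf (mkDist P.lip) Set.univ (pullbackStates γ.left (levelOne γ.pivot)))
    (hausdorffOf (mkDist Q.lip) Set.univ (pullbackStates γ.right (levelOne γ.pivot)))

/-- The length of a bridge. -/
def Bridge.length (γ : Bridge P.carrier Q.carrier) : ℝ≥0∞ :=
  max γ.reach γ.height

/-- A trek: a finite nonempty chain of bridges whose vertices are all quasi-Leibniz compact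
quantum metric spaces. -/
inductive Trek : LipPair.{u} → LipPair.{u} → Type (u + 1)
  | single {P Q : LipPair.{u}} (hP : P.IsQuasiLeibniz) (hQ : Q.IsQuasiLeibniz)
      (γ : Bridge P.carrier Q.carrier) : Trek P Q
  | cons {P Q R : LipPair.{u}} (hP : P.IsQuasiLeibniz)
      (γ : Bridge P.carrier Q.carrier) (T : Trek Q R) : Trek P R

/-- The length of a trek: the sum of the lengths of its bridges. -/
def Trek.length : {P Q : LipPair.{u}} → Trek P Q → ℝ≥0∞
  | _, _, .single _ _ γ => γ.length
  | _, _, .cons _ γ T => γ.length + T.length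

/-- The quantum Gromov-Hausdorff propinquity. -/
def propinquity (P Q : LipPair.{u}) : ℝ≥0∞ := ⨅ T : Trek P Q, T.length

end Propinquity

section Homogeneous

/-- The direct sum of the matrix algebras `M_{m 0}(ℂ), …, M_{m n}(ℂ)`, with entrywise operations
and the maximum of the operator norms on the Hilbert spaces `ℂ ^ (m l)`. -/
abbrev MatrixSum {n : ℕ} (m : Fin (n + 1) → ℕ) : Type :=
  ∀ l : Fin (n + 1), Matrix (Fin (m l)) (Fin (m l)) ℂ

/-- The largest of the matrix sizes. -/
def maxSize {n : ℕ} (m : Fin (n + 1) → ℕ) : ℕ := Finset.univ.sup m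

/-- The maximum of `|Re|` and `|Im|` over all the matrix entries. -/
def entryNorm {n : ℕ} {m : Fin (n + 1) → ℕ} (a : MatrixSum m) : ℝ≥0 :=
  Finset.univ.sup fun l => Finset.univ.sup fun j => Finset.univ.sup fun k =>
    max ‖(a l j k).re‖₊ ‖(a l j k).im‖₊

variable (X : Type u) [MetricSpace X] [CompactSpace X] {n : ℕ} (m : Fin (n + 1) → ℕ)

/-- The Lipschitz constant of `a` with respect to `entryNorm`. -/
def lipConst (a : C(X, MatrixSum m)) : ℝ≥0∞ :=
  ⨆ (x : X) (y : X) (_ : x ≠ y), (entryNorm (a x - a y) : ℝ≥0∞) / edist x y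

/-- The distance of `a` to the real scalars, in the supremum norm induced by `entryNorm`. -/
def distScalars (a : C(X, MatrixSum m)) : ℝ≥0∞ :=
  ⨅ r : ℝ, ⨆ x : X, (entryNorm (a x - (r : ℂ) • (1 : MatrixSum m)) : ℝ≥0∞)

/-- The C*-algebra `C(X, 𝔄)`, where `𝔄` is the direct sum of matrix algebras of sizes `m`,
with the maximum of `lipConst` and `distScalars`. -/
def homogeneous : LipPair.{u} where
  carrier := C(X, MatrixSum m)
  lip a := max (lipConst X m a) (distScalars X m a)

end Homogeneous

end QuantumMetric

end

/-!
In the `2 · ∑ l, m l ^ 2` real coordinates given by the real and imaginary parts of the matrix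
entries, `entryNorm` is a supremum norm, and `entryNorm ≤ ‖·‖ ≤ √2 m_𝔄 entryNorm`. The second
inequality is where the Leibniz constant `√2 m_𝔄` comes from. It also makes the elements with
`L_X ≤ 1` equicontinuous and, modulo the real scalars, bounded, hence totally bounded by
Arzelà–Ascoli; by Rieffel's criterion `L_X` is then a Lip-norm.

Let `Y ⊆ X` be an `r`-net. Restriction from `X` to `Y` does not increase `L`, and conversely every
`a` over `Y` extends to `X` with the same `L`: extend each real coordinate by McShane's formula,
clamp it around that of the scalar nearest to `a`, and take the self-adjoint part. Pull both
algebras back to `Z = {(y, x) | d(y, x) ≤ r}`. In the bridge `C(Z, 𝔄)` with pivot `1` every state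
is a level state and every state of either algebra extends by Hahn–Banach, so the height is zero;
and if `b` restricts to `a`, their pullbacks are at distance at most `√2 m_𝔄 r L_X(b)`.
-/

namespace QuantumMetric

section States

variable {A D : Type u} [CStarAlgebra A] [CStarAlgebra D]

theorem norm_positiveLinearMap_apply_le [PartialOrder A] [StarOrderedRing A] (f : A →ₚ[ℂ] ℂ)
    (a : A) : ‖f a‖ ≤ ‖f 1‖ * ‖a‖ := by
  have norm_sq (b : A) : ‖f.toPreGNS b‖ ^ 2 = ‖f (star b * b)‖ := by
    have h := congrArg norm (f.preGNS_norm_sq (f.toPreGNS b))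
    rwa [f.ofPreGNS_toPreGNS, norm_pow, Complex.norm_real, norm_norm] at h
  have norm_sq_one : ‖f.toPreGNS 1‖ ^ 2 = ‖f 1‖ := by rw [norm_sq, star_one, one_mul]
  have norm_sq_le : ‖f.toPreGNS a‖ ^ 2 ≤ ‖f 1‖ * ‖a‖ ^ 2 := by
    rw [norm_sq, sq ‖a‖, ← CStarRing.norm_star_mul_self]
    exact f.norm_apply_le_of_nonneg _ (star_mul_self_nonneg a)
  have inner_eq : inner ℂ (f.toPreGNS 1) (f.toPreGNS a) = f a := by
    simp [f.preGNS_inner_def]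
  refine le_of_sq_le_sq ?_ (by positivity)
  calc ‖f a‖ ^ 2 ≤ (‖f.toPreGNS 1‖ * ‖f.toPreGNS a‖) ^ 2 := by
        rw [← inner_eq]; gcongr; exact norm_inner_le_norm _ _
    _ = ‖f 1‖ * ‖f.toPreGNS a‖ ^ 2 := by rw [mul_pow, norm_sq_one]
    _ ≤ ‖f 1‖ * (‖f 1‖ * ‖a‖ ^ 2) := by gcongr
    _ = (‖f 1‖ * ‖a‖) ^ 2 := by ring

theorem norm_state_apply_le (φ : StateSpace A) (a : A) : ‖φ.1 a‖ ≤ ‖a‖ := by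
  let _ : PartialOrder A := CStarAlgebra.spectralOrder A
  have _ : StarOrderedRing A := CStarAlgebra.spectralOrderedRing A
  obtain ⟨φ, map_one, map_star_mul_self⟩ := φ
  let f : A →ₚ[ℂ] ℂ := PositiveLinearMap.mk₀ (φ : A →ₗ[ℂ] ℂ) fun b hb => by
    obtain ⟨c, rfl⟩ := CStarAlgebra.nonneg_iff_eq_star_mul_self.1 hb
    exact map_star_mul_self c
  have f_one : f 1 = 1 := map_one
  have norm_f_le := norm_positiveLinearMap_apply_le f a
  rwa [f_one, norm_one, one_mul] at norm_f_le

theorem enorm_state_apply_le (φ : StateSpace A) (a : A) : ‖φ.1 a‖ₑ ≤ ‖a‖ₑ :=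
  enorm_le_iff_norm_le.2 (norm_state_apply_le φ a)

theorem norm_add_smul_I_smul_one_sq_le [Nontrivial A] {a : A} (ha : IsSelfAdjoint a) (t : ℝ) :
    ‖a + (t * Complex.I) • (1 : A)‖ ^ 2 ≤ ‖a‖ ^ 2 + t ^ 2 := by
  have I_mul_conj : (t * Complex.I) * (t * -Complex.I) = (t : ℂ) ^ 2 := by
    linear_combination (-(t : ℂ) ^ 2) * Complex.I_mul_I
  have star_mul_self : star (a + (t * Complex.I) • (1 : A)) * (a + (t * Complex.I) • (1 : A))
      = a * a + ((t : ℂ) ^ 2) • (1 : A) := by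
    simp only [star_add, ha.star_eq, star_smul, star_one, add_mul, mul_add, smul_mul_assoc,
      mul_smul_comm, one_mul, mul_one, star_mul', Complex.star_def, Complex.conj_ofReal,
      Complex.conj_I]
    rw [smul_add, smul_smul, I_mul_conj, mul_neg, neg_smul]
    abel
  calc ‖a + (t * Complex.I) • (1 : A)‖ ^ 2
      = ‖a * a + ((t : ℂ) ^ 2) • (1 : A)‖ := by
        rw [sq, ← CStarRing.norm_star_mul_self, star_mul_self]
    _ ≤ ‖a * a‖ + ‖((t : ℂ) ^ 2) • (1 : A)‖ := norm_add_le _ _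
    _ = ‖a‖ ^ 2 + t ^ 2 := by
        rw [ha.norm_mul_self, norm_smul, norm_pow, Complex.norm_real, norm_one, mul_one,
          Real.norm_eq_abs, sq_abs]

theorem im_apply_eq_zero_of_norm_apply_le {φ : WeakDual ℂ A} (h1 : φ 1 = 1)
    (hφ : ∀ a, ‖φ a‖ ≤ ‖a‖) {a : A} (ha : IsSelfAdjoint a) : (φ a).im = 0 := by
  have : Nontrivial A := ⟨1, 0, fun h => one_ne_zero (h1.symm.trans (h ▸ map_zero φ))⟩
  have sq_im_add_le (t : ℝ) : ((φ a).im + t) ^ 2 ≤ ‖a‖ ^ 2 + t ^ 2 := by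
    have apply_add : φ (a + (t * Complex.I) • 1) = φ a + t * Complex.I := by
      rw [map_add, map_smul, h1, smul_eq_mul, mul_one]
    calc ((φ a).im + t) ^ 2 = (φ a + t * Complex.I).im ^ 2 := by simp
      _ ≤ ‖φ a + t * Complex.I‖ ^ 2 := sq_le_sq.2 (by
          simpa only [abs_norm] using Complex.abs_im_le_norm _)
      _ ≤ ‖a + (t * Complex.I) • (1 : A)‖ ^ 2 := by rw [← apply_add]; gcongr; exact hφ _
      _ ≤ ‖a‖ ^ 2 + t ^ 2 := norm_add_smul_I_smul_one_sq_le ha t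
  by_contra him
  have := sq_im_add_le ((‖a‖ ^ 2 + 1) / (2 * (φ a).im))
  have : (φ a).im * ((‖a‖ ^ 2 + 1) / (2 * (φ a).im)) = (‖a‖ ^ 2 + 1) / 2 := by field_simp
  nlinarith [sq_nonneg (φ a).im]

theorem mem_stateSpace_of_norm_apply_le {φ : WeakDual ℂ A} (h1 : φ 1 = 1)
    (hφ : ∀ a, ‖φ a‖ ≤ ‖a‖) : φ ∈ StateSpace A := by
  refine ⟨h1, fun a => ?_⟩
  let _ : PartialOrder A := CStarAlgebra.spectralOrder A
  have _ : StarOrderedRing A := CStarAlgebra.spectralOrderedRing A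
  have : Nontrivial A := ⟨1, 0, fun h => one_ne_zero (h1.symm.trans (h ▸ map_zero φ))⟩
  set p := star a * a
  have hp : IsSelfAdjoint p := .star_mul_self a
  have norm_sub_le : ‖algebraMap ℝ A ‖p‖ - p‖ ≤ ‖p‖ := by
    refine (CStarAlgebra.norm_le_norm_of_nonneg_of_le (sub_nonneg.2 hp.le_algebraMap_norm_self)
      (sub_le_self _ (star_mul_self_nonneg a))).trans_eq ?_
    rw [norm_algebraMap', norm_norm]
  have apply_sub : φ (algebraMap ℝ A ‖p‖ - p) = ‖p‖ - φ p := by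
    rw [map_sub, IsScalarTower.algebraMap_apply ℝ ℂ A, Algebra.algebraMap_eq_smul_one, map_smul,
      h1, smul_eq_mul, mul_one, Complex.coe_algebraMap]
  have abs_re_le : |‖p‖ - (φ p).re| ≤ ‖p‖ := by
    simpa [apply_sub] using (Complex.abs_re_le_norm _).trans ((hφ _).trans norm_sub_le)
  exact Complex.nonneg_iff.2
    ⟨by linarith [(abs_le.1 abs_re_le).2], (im_apply_eq_zero_of_norm_apply_le h1 hφ hp).symm⟩

theorem nonempty_stateSpace [Nontrivial A] : Nonempty (StateSpace A) := by
  obtain ⟨g, hg, hg1⟩ := exists_dual_vector ℂ (1 : A) (by simp)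
  refine ⟨⟨(g : WeakDual ℂ A), mem_stateSpace_of_norm_apply_le ?_ fun a => ?_⟩⟩
  · exact hg1.trans (by simp)
  · exact (g.le_opNorm a).trans (by rw [hg, one_mul])

theorem pullbackStates_univ {π : A →⋆ₐ[ℂ] D} (hπ : Function.Injective π) :
    pullbackStates π Set.univ = Set.univ := by
  refine Set.eq_univ_of_forall fun ψ => ?_
  let e := LinearIsometry.equivRange ⟨(π : A →ₗ[ℂ] D), NonUnitalStarAlgHom.norm_map π hπ⟩
  let ψ' : StrongDual ℂ A := ψ.1
  obtain ⟨g, hg, norm_g⟩ := exists_extension_norm_eq (LinearMap.range (π : A →ₗ[ℂ] D))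
    (ψ'.comp (e.symm : _ →L[ℂ] A))
  have g_apply (a : A) : g (π a) = ψ.1 a :=
    (hg (e a)).trans (congrArg ψ' (e.symm_apply_apply a))
  have norm_g_le : ‖g‖ ≤ 1 := norm_g ▸ ContinuousLinearMap.opNorm_le_bound _ zero_le_one
    fun x => by
      rw [one_mul]
      exact (norm_state_apply_le ψ (e.symm x)).trans_eq (e.symm.norm_map x)
  refine ⟨⟨(g : WeakDual ℂ D), mem_stateSpace_of_norm_apply_le ?_ fun a => ?_⟩, trivial,
    fun a => (g_apply a).symm⟩
  · exact (congrArg g (map_one π).symm).trans ((g_apply 1).trans ψ.2.1)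
  · exact g.le_of_opNorm_le_of_le norm_g_le le_rfl |>.trans_eq (one_mul _)

theorem levelOne_one : levelOne (1 : D) = Set.univ := by
  ext φ; simp [levelOne]

theorem mkDist_self (L : selfAdjoint A → ℝ≥0∞) (φ : StateSpace A) : mkDist L φ φ = 0 := by
  simp [mkDist]

theorem hausdorffOf_self {S : Type*} {d : S → S → ℝ≥0∞} (hd : ∀ x, d x x = 0) (s : Set S) :
    hausdorffOf d s s = 0 :=
  le_antisymm (max_le (iSup₂_le fun x hx => iInf₂_le_of_le x hx (hd x).le)
    (iSup₂_le fun x hx => iInf₂_le_of_le x hx (hd x).le)) zero_le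

theorem height_eq_zero_of_pivot_eq_one {P Q : LipPair.{u}} {γ : Bridge P.carrier Q.carrier}
    (h : γ.pivot = 1) : γ.height = 0 := by
  rw [Bridge.height, h, levelOne_one, pullbackStates_univ γ.left_injective,
    pullbackStates_univ γ.right_injective, hausdorffOf_self (mkDist_self _),
    hausdorffOf_self (mkDist_self _), max_self]

end States

section RieffelCriterion

variable {A : Type u} [CStarAlgebra A] {L : selfAdjoint A → ℝ≥0∞} {K : Set A}

theorem enorm_state_sub_apply_le (φ ψ : StateSpace A) (a : A) :
    ‖φ.1 a - ψ.1 a‖ₑ ≤ ‖a‖ₑ + ‖a‖ₑ :=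
  enorm_sub_le.trans (add_le_add (enorm_state_apply_le φ a) (enorm_state_apply_le ψ a))

theorem enorm_state_sub_apply_le_add (φ ψ : StateSpace A) (a c : A) :
    ‖φ.1 a - ψ.1 a‖ₑ ≤ edist a c + edist a c + ‖φ.1 c - ψ.1 c‖ₑ := by
  have split : φ.1 a - ψ.1 a = (φ.1 (a - c) - ψ.1 (a - c)) + (φ.1 c - ψ.1 c) := by
    simp only [map_sub]; ring
  rw [split, edist_eq_enorm_sub]
  exact (enorm_add_le _ _).trans (add_le_add (enorm_state_sub_apply_le φ ψ _) le_rfl)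

theorem state_sub_apply_sub_smul_one (φ ψ : StateSpace A) (a : A) (r : ℝ) :
    φ.1 (a - r • 1) - ψ.1 (a - r • 1) = φ.1 a - ψ.1 a := by
  simp only [← Complex.coe_smul, map_sub, map_smul, φ.2.1, ψ.2.1]
  ring

theorem enorm_apply_sub_le_mul_mkDist (hsmul : ∀ (t : ℝ) a, L (t • a) = ‖t‖ₑ * L a)
    (φ ψ : StateSpace A) {c : selfAdjoint A} {t : ℝ} (ht : t ≠ 0) (hc : L c ≤ ‖t‖ₑ) :
    ‖φ.1 (c : A) - ψ.1 (c : A)‖ₑ ≤ ‖t‖ₑ * mkDist L φ ψ := by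
  have L_inv_smul_le : L (t⁻¹ • c) ≤ 1 := by
    rw [hsmul, enorm_inv ht, mul_comm, ← div_eq_mul_inv]
    exact ENNReal.div_le_of_le_mul (by rwa [one_mul])
  have smul_inv_smul : (c : A) = (t : ℂ) • ((t⁻¹ • c : selfAdjoint A) : A) := by
    rw [selfAdjoint.val_smul, Complex.coe_smul, smul_inv_smul₀ ht]
  rw [smul_inv_smul, map_smul, map_smul, ← smul_sub, enorm_smul,
    enorm_eq_iff_norm_eq.2 (Complex.norm_real t)]
  gcongr
  exact le_iSup₂_of_le _ L_inv_smul_le le_rfl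

theorem mkDist_ne_top_of_isBounded (hK : Bornology.IsBounded K)
    (hLK : ∀ a : selfAdjoint A, L a ≤ 1 → ∃ r : ℝ, (a : A) - r • 1 ∈ K)
    (φ ψ : StateSpace A) : mkDist L φ ψ ≠ ∞ := by
  obtain ⟨R, -, hR⟩ := hK.exists_pos_norm_le
  refine ne_top_of_le_ne_top (b := ENNReal.ofReal R + ENNReal.ofReal R) (by simp)
    (iSup₂_le fun a ha => ?_)
  obtain ⟨r, hr⟩ := hLK a ha
  have enorm_le : ‖(a : A) - r • 1‖ₑ ≤ ENNReal.ofReal R := by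
    rw [← ofReal_norm]
    exact ENNReal.ofReal_le_ofReal (hR _ hr)
  rw [← state_sub_apply_sub_smul_one φ ψ a r]
  exact (enorm_state_sub_apply_le φ ψ _).trans (add_le_add enorm_le enorm_le)

theorem tendsto_mkDist_of_totallyBounded (hK : TotallyBounded K)
    (hLK : ∀ a : selfAdjoint A, L a ≤ 1 → ∃ r : ℝ, (a : A) - r • 1 ∈ K)
    (φ : StateSpace A) : Tendsto (mkDist L φ) (𝓝 φ) (𝓝 0) := by
  refine ENNReal.tendsto_nhds_zero.2 fun ε hε => ?_
  have hε3 : 0 < ε / 3 := ENNReal.div_pos hε.ne' (by simp)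
  obtain ⟨t, ht, hKt⟩ := EMetric.totallyBounded_iff.1 hK (ε / 3) hε3
  have eventually_lt : ∀ c ∈ t, ∀ᶠ ψ : StateSpace A in 𝓝 φ, ‖φ.1 c - ψ.1 c‖ₑ < ε / 3 := by
    intro c _
    have hc : Continuous fun ψ : StateSpace A => ‖φ.1 c - ψ.1 c‖ₑ :=
      (continuous_const.sub ((WeakDual.eval_continuous c).comp continuous_subtype_val)).enorm
    exact (hc.tendsto φ).eventually_lt_const (by simpa using hε3)
  filter_upwards [(Filter.eventually_all_finite ht).2 eventually_lt] with ψ hψ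
  refine iSup₂_le fun a ha => ?_
  obtain ⟨r, hr⟩ := hLK a ha
  obtain ⟨c, hc, hac⟩ := Set.mem_iUnion₂.1 (hKt hr)
  have hac' : edist ((a : A) - r • 1) c ≤ ε / 3 := (Metric.mem_eball.1 hac).le
  calc ‖φ.1 (a : A) - ψ.1 (a : A)‖ₑ
      = ‖φ.1 ((a : A) - r • 1) - ψ.1 ((a : A) - r • 1)‖ₑ := by
        rw [state_sub_apply_sub_smul_one]
    _ ≤ ε / 3 + ε / 3 + ε / 3 := (enorm_state_sub_apply_le_add φ ψ _ c).trans
        (add_le_add (add_le_add hac' hac') (hψ c hc).le)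
    _ = ε := ENNReal.add_thirds ε

theorem tendsto_apply_of_tendsto_mkDist (hsmul : ∀ (t : ℝ) a, L (t • a) = ‖t‖ₑ * L a)
    (hdense : Dense {a | L a < ∞}) {φ : StateSpace A} {F : Filter (StateSpace A)}
    (hF : Tendsto (mkDist L φ) F (𝓝 0)) (a : selfAdjoint A) :
    Tendsto (fun ψ : StateSpace A => ψ.1 (a : A)) F (𝓝 (φ.1 (a : A))) := by
  refine tendsto_iff_edist_tendsto_0.2 (ENNReal.tendsto_nhds_zero.2 fun ε hε => ?_)
  have hε3 : 0 < ε / 3 := ENNReal.div_pos hε.ne' (by simp)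
  obtain ⟨c, hc : L c < ∞, hac⟩ := EMetric.mem_closure_iff.1 (hdense a) (ε / 3) hε3
  have hac' : edist (a : A) c ≤ ε / 3 := hac.le
  set t := (L c).toReal + 1
  have ht : 0 < t := by positivity
  have hct : L c ≤ ‖t‖ₑ := by
    rw [Real.enorm_eq_ofReal ht.le, ENNReal.le_ofReal_iff_toReal_le hc.ne ht.le]
    exact (lt_add_one _).le
  have tendsto_mul : Tendsto (fun ψ => ‖t‖ₑ * mkDist L φ ψ) F (𝓝 0) := by
    simpa using ENNReal.Tendsto.const_mul hF (Or.inr enorm_ne_top)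
  filter_upwards [ENNReal.tendsto_nhds_zero.1 tendsto_mul _ hε3] with ψ hψ
  calc edist (ψ.1 (a : A)) (φ.1 (a : A))
      = ‖φ.1 (a : A) - ψ.1 (a : A)‖ₑ := by rw [edist_comm, edist_eq_enorm_sub]
    _ ≤ ε / 3 + ε / 3 + ε / 3 := (enorm_state_sub_apply_le_add φ ψ _ (c : A)).trans
        (add_le_add (add_le_add hac' hac')
          ((enorm_apply_sub_le_mul_mkDist hsmul φ ψ ht.ne' hct).trans hψ))
    _ = ε := ENNReal.add_thirds ε

theorem nhds_eq_comap_mkDist (hsmul : ∀ (t : ℝ) a, L (t • a) = ‖t‖ₑ * L a)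
    (hdense : Dense {a | L a < ∞}) (hK : TotallyBounded K)
    (hLK : ∀ a : selfAdjoint A, L a ≤ 1 → ∃ r : ℝ, (a : A) - r • 1 ∈ K)
    (φ : StateSpace A) : 𝓝 φ = comap (mkDist L φ) (𝓝 0) := by
  refine le_antisymm (tendsto_iff_comap.1 (tendsto_mkDist_of_totallyBounded hK hLK φ)) ?_
  rw [nhds_subtype, ← tendsto_iff_comap]
  refine (WeakBilin.tendsto_iff_forall_eval_tendsto _ ContinuousLinearMap.coe_injective).2
    fun a => ?_
  have split (ψ : StateSpace A) :
      ψ.1 (realPart a : A) + Complex.I • ψ.1 (imaginaryPart a : A) = ψ.1 a := by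
    rw [← map_smul, ← map_add, realPart_add_I_smul_imaginaryPart]
  have tendsto_selfAdjoint := tendsto_apply_of_tendsto_mkDist hsmul hdense
    (tendsto_comap (f := mkDist L φ) (x := 𝓝 0))
  suffices Tendsto (fun ψ : StateSpace A => ψ.1 a) (comap (mkDist L φ) (𝓝 0)) (𝓝 (φ.1 a)) from
    this
  simpa only [split] using (tendsto_selfAdjoint (realPart a)).add
    ((tendsto_selfAdjoint (imaginaryPart a)).const_smul Complex.I)

theorem isLipNorm_of_totallyBounded (hadd : ∀ a b, L (a + b) ≤ L a + L b)
    (hsmul : ∀ (t : ℝ) a, L (t • a) = ‖t‖ₑ * L a) (hlsc : LowerSemicontinuous L)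
    (hdense : Dense {a | L a < ∞})
    (hzero : ∀ a, L a = 0 ↔ ∃ t : ℝ, a = t • (1 : selfAdjoint A)) (hK : TotallyBounded K)
    (hLK : ∀ a : selfAdjoint A, L a ≤ 1 → ∃ r : ℝ, (a : A) - r • 1 ∈ K) : IsLipNorm L where
  add_le := hadd
  smul := hsmul
  dense_dom := hdense
  eq_zero_iff := hzero
  mkDist_ne_top := mkDist_ne_top_of_isBounded hK.isBounded hLK
  nhds_basis φ := by
    rw [nhds_eq_comap_mkDist hsmul hdense hK hLK φ]
    exact ENNReal.nhds_zero_basis.comap _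
  lsc := hlsc

end RieffelCriterion

section MatrixNorm

variable {ι 𝕜 : Type*} [Fintype ι] [DecidableEq ι] [RCLike 𝕜]

theorem norm_entry_le_l2_opNorm (A : Matrix ι ι 𝕜) (j k : ι) : ‖A j k‖ ≤ ‖A‖ := by
  have h := A.l2_opNorm_mulVec (EuclideanSpace.single k 1)
  rw [PiLp.norm_single, norm_one, mul_one] at h
  refine le_trans (le_of_eq ?_) ((PiLp.norm_apply_le _ j).trans h)
  simp

theorem l2_opNorm_le_mul_card {A : Matrix ι ι 𝕜} {s : ℝ} (hs : 0 ≤ s)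
    (hA : ∀ j k, ‖A j k‖ ≤ s) : ‖A‖ ≤ s * Fintype.card ι := by
  rw [Matrix.cstar_norm_def]
  refine ContinuousLinearMap.opNorm_le_bound _ (by positivity) fun v => ?_
  have norm_apply_le (j : ι) : ‖Matrix.toEuclideanCLM (𝕜 := 𝕜) A v j‖ ≤ s * ∑ k, ‖v k‖ := by
    rw [Matrix.ofLp_toEuclideanCLM, Matrix.mulVec, dotProduct, Finset.mul_sum]
    refine norm_sum_le_of_le _ fun k _ => ?_
    rw [norm_mul]
    gcongr
    exact hA j k
  refine le_of_sq_le_sq ?_ (by positivity)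
  calc ‖Matrix.toEuclideanCLM (𝕜 := 𝕜) A v‖ ^ 2
      = ∑ j, ‖Matrix.toEuclideanCLM (𝕜 := 𝕜) A v j‖ ^ 2 := EuclideanSpace.norm_sq_eq _
    _ ≤ ∑ _j : ι, (s * ∑ k, ‖v k‖) ^ 2 := by gcongr with j; exact norm_apply_le j
    _ = Fintype.card ι * s ^ 2 * (∑ k, ‖v k‖) ^ 2 := by simp; ring
    _ ≤ Fintype.card ι * s ^ 2 * (Fintype.card ι * ∑ k, ‖v k‖ ^ 2) := by
        gcongr
        exact sq_sum_le_card_mul_sum_sq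
    _ = (s * Fintype.card ι * ‖v‖) ^ 2 := by rw [mul_pow, EuclideanSpace.norm_sq_eq v]; ring

end MatrixNorm

section RealEntries

variable {n : ℕ} {m : Fin (n + 1) → ℕ}

/-- The positions of the entries in `MatrixSum m`: a block together with a row and a column. -/
abbrev EntryIndex {n : ℕ} (m : Fin (n + 1) → ℕ) : Type := Σ l, Fin (m l) × Fin (m l)

/-- The real coordinates of an element of `MatrixSum m`: the real parts of the entries on the left
summand, their imaginary parts on the right one. It turns `entryNorm` into the supremum norm. -/
noncomputable def realEntries : MatrixSum m ≃L[ℝ] (EntryIndex m ⊕ EntryIndex m → ℝ) :=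
  LinearEquiv.toContinuousLinearEquiv
    { toFun a := Sum.elim (fun i => (a i.1 i.2.1 i.2.2).re) fun i => (a i.1 i.2.1 i.2.2).im
      invFun v l := .of fun j k => ⟨v (.inl ⟨l, j, k⟩), v (.inr ⟨l, j, k⟩)⟩
      map_add' a b := by ext (i | i) <;> simp
      map_smul' t a := by ext (i | i) <;> simp
      left_inv a := rfl
      right_inv v := by ext (i | i) <;> rfl }

@[simp]
theorem realEntries_inl (a : MatrixSum m) (i : EntryIndex m) :
    realEntries a (.inl i) = (a i.1 i.2.1 i.2.2).re := rfl

@[simp]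
theorem realEntries_inr (a : MatrixSum m) (i : EntryIndex m) :
    realEntries a (.inr i) = (a i.1 i.2.1 i.2.2).im := rfl

theorem nnnorm_realEntries (a : MatrixSum m) : ‖realEntries a‖₊ = entryNorm a := by
  refine eq_of_forall_ge_iff fun c => ?_
  simp [pi_nnnorm_le_iff, entryNorm, Finset.sup_le_iff, Sigma.forall, Prod.forall, forall_and]

theorem coe_entryNorm (a : MatrixSum m) : (entryNorm a : ℝ≥0∞) = ‖realEntries a‖ₑ := by
  rw [← nnnorm_realEntries, enorm_eq_nnnorm]

theorem norm_realEntries_star (a : MatrixSum m) : ‖realEntries (star a)‖ = ‖realEntries a‖ := by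
  have norm_star_le (b : MatrixSum m) : ‖realEntries (star b)‖ ≤ ‖realEntries b‖ := by
    refine (pi_norm_le_iff_of_nonneg (norm_nonneg _)).2 ?_
    rintro (⟨l, j, k⟩ | ⟨l, j, k⟩)
    · simpa using norm_le_pi_norm (realEntries b) (.inl ⟨l, k, j⟩)
    · simpa using norm_le_pi_norm (realEntries b) (.inr ⟨l, k, j⟩)
  exact le_antisymm (norm_star_le a) (by simpa only [star_star] using norm_star_le (star a))

theorem norm_realEntries_le (a : MatrixSum m) : ‖realEntries a‖ ≤ ‖a‖ := by
  refine (pi_norm_le_iff_of_nonneg (norm_nonneg a)).2 ?_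
  have norm_entry_le (i : EntryIndex m) : ‖a i.1 i.2.1 i.2.2‖ ≤ ‖a‖ :=
    (norm_entry_le_l2_opNorm _ _ _).trans (norm_le_pi_norm a i.1)
  rintro (i | i)
  · exact (Complex.abs_re_le_norm _).trans (norm_entry_le i)
  · exact (Complex.abs_im_le_norm _).trans (norm_entry_le i)

theorem norm_le_mul_norm_realEntries (a : MatrixSum m) :
    ‖a‖ ≤ √2 * maxSize m * ‖realEntries a‖ := by
  refine (pi_norm_le_iff_of_nonneg (by positivity)).2 fun l => ?_
  have norm_entry_le (j k : Fin (m l)) : ‖a l j k‖ ≤ √2 * ‖realEntries a‖ := by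
    refine (Complex.norm_le_sqrt_two_mul_max _).trans ?_
    gcongr
    exact max_le (norm_le_pi_norm (realEntries a) (.inl ⟨l, j, k⟩))
      (norm_le_pi_norm (realEntries a) (.inr ⟨l, j, k⟩))
  calc ‖a l‖ ≤ √2 * ‖realEntries a‖ * m l := by
        simpa using l2_opNorm_le_mul_card (by positivity) norm_entry_le
    _ ≤ √2 * ‖realEntries a‖ * maxSize m := by
        gcongr
        exact Finset.le_sup (f := m) (Finset.mem_univ l)
    _ = √2 * maxSize m * ‖realEntries a‖ := by ring

theorem enorm_realEntries_le (a : MatrixSum m) : ‖realEntries a‖ₑ ≤ ‖a‖ₑ :=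
  enorm_le_iff_norm_le.2 (norm_realEntries_le a)

theorem enorm_le_mul_enorm_realEntries (a : MatrixSum m) :
    ‖a‖ₑ ≤ ENNReal.ofReal (√2 * maxSize m) * ‖realEntries a‖ₑ := by
  rw [← ofReal_norm, ← ofReal_norm, ← ENNReal.ofReal_mul (by positivity)]
  exact ENNReal.ofReal_le_ofReal (norm_le_mul_norm_realEntries a)

end RealEntries

section Seminorm

theorem eq_enorm_mul_of_smul_le {E : Type*} [AddCommGroup E] [Module ℝ E] {N : E → ℝ≥0∞}
    (hN : ∀ (t : ℝ) a, N (t • a) ≤ ‖t‖ₑ * N a) (t : ℝ) (a : E) : N (t • a) = ‖t‖ₑ * N a := by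
  refine le_antisymm (hN t a) ?_
  obtain rfl | ht := eq_or_ne t 0
  · simp
  · calc ‖t‖ₑ * N a = ‖t‖ₑ * N (t⁻¹ • t • a) := by rw [inv_smul_smul₀ ht]
      _ ≤ ‖t‖ₑ * (‖t⁻¹‖ₑ * N (t • a)) := by gcongr; exact hN _ _
      _ = N (t • a) := by rw [← mul_assoc, ← enorm_mul, mul_inv_cancel₀ ht, enorm_one, one_mul]

variable {X : Type u} [MetricSpace X] {n : ℕ} {m : Fin (n + 1) → ℕ}

theorem lipConst_le_iff {a : C(X, MatrixSum m)} {c : ℝ≥0∞} :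
    lipConst X m a ≤ c ↔ ∀ x y, ‖realEntries (a x - a y)‖ₑ ≤ c * edist x y := by
  simp only [lipConst, iSup_le_iff, coe_entryNorm]
  refine forall₂_congr fun x y => ?_
  obtain rfl | hxy := eq_or_ne x y
  · simp
  · simp only [ne_eq, hxy, not_false_eq_true, true_imp_iff]
    exact ENNReal.div_le_iff (edist_pos.2 hxy).ne' (edist_ne_top x y)

theorem enorm_realEntries_sub_le (a : C(X, MatrixSum m)) (x y : X) :
    ‖realEntries (a x - a y)‖ₑ ≤ lipConst X m a * edist x y :=
  lipConst_le_iff.1 le_rfl x y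

theorem lipConst_le_coe_iff {a : C(X, MatrixSum m)} {K : ℝ≥0} :
    lipConst X m a ≤ K ↔ LipschitzWith K fun x => realEntries (a x) := by
  simp only [lipConst_le_iff, LipschitzWith, edist_eq_enorm_sub (realEntries _), map_sub]

theorem distScalars_le {a : C(X, MatrixSum m)} {c : ℝ≥0∞} (r : ℝ)
    (h : ∀ x, ‖realEntries (a x - r • 1)‖ₑ ≤ c) : distScalars X m a ≤ c :=
  iInf_le_of_le r (iSup_le fun x => by simpa only [coe_entryNorm, Complex.coe_smul] using h x)

theorem le_distScalars {a : C(X, MatrixSum m)} {c : ℝ≥0∞}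
    (h : ∀ r : ℝ, c ≤ ⨆ x, ‖realEntries (a x - r • 1)‖ₑ) : c ≤ distScalars X m a :=
  le_iInf fun r => by simpa only [coe_entryNorm, Complex.coe_smul] using h r

theorem lipConst_add_le (a b : C(X, MatrixSum m)) :
    lipConst X m (a + b) ≤ lipConst X m a + lipConst X m b := by
  refine lipConst_le_iff.2 fun x y => ?_
  rw [ContinuousMap.add_apply, ContinuousMap.add_apply, add_sub_add_comm, map_add, add_mul]
  exact (enorm_add_le _ _).trans
    (add_le_add (enorm_realEntries_sub_le a x y) (enorm_realEntries_sub_le b x y))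

theorem lipConst_smul_le (t : ℝ) (a : C(X, MatrixSum m)) :
    lipConst X m (t • a) ≤ ‖t‖ₑ * lipConst X m a := by
  refine lipConst_le_iff.2 fun x y => ?_
  rw [ContinuousMap.smul_apply, ContinuousMap.smul_apply, ← smul_sub, map_smul, enorm_smul,
    mul_assoc]
  gcongr
  exact enorm_realEntries_sub_le a x y

theorem lowerSemicontinuous_lipConst : LowerSemicontinuous (lipConst X m) := by
  refine lowerSemicontinuous_iSup fun x => lowerSemicontinuous_iSup fun y =>
    lowerSemicontinuous_iSup fun hxy => Continuous.lowerSemicontinuous ?_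
  simp only [coe_entryNorm]
  exact (ENNReal.continuous_div_const _ (edist_pos.2 hxy).ne').comp (realEntries.continuous.comp
    ((continuous_eval_const x).sub (continuous_eval_const y))).enorm

theorem lipConst_smul_one (t : ℝ) : lipConst X m (t • 1) = 0 :=
  le_antisymm (lipConst_le_iff.2 fun x y => by simp) zero_le

theorem realEntries_one_eq_zero_or_one (i : EntryIndex m ⊕ EntryIndex m) :
    realEntries (1 : MatrixSum m) i = 0 ∨ realEntries (1 : MatrixSum m) i = 1 := by
  obtain ⟨l, j, k⟩ | ⟨l, j, k⟩ := i <;> obtain rfl | hjk := eq_or_ne j k <;> simp [*]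

theorem abs_sub_clamp_le {M x : ℝ} (hx : |x| ≤ M) (y : ℝ) :
    |x - max (-M) (min M y)| ≤ |x - y| := by
  grind

theorem norm_realEntries_sub_clamp_le {M : ℝ} {p : MatrixSum m} (hp : ‖p‖ ≤ M) (r : ℝ) :
    ‖realEntries (p - max (-M) (min M r) • 1)‖ ≤ ‖realEntries (p - r • 1)‖ := by
  refine (pi_norm_le_iff_of_nonneg (norm_nonneg _)).2 fun i => ?_
  refine le_trans ?_ (norm_le_pi_norm _ i)
  simp only [map_sub, map_smul, Pi.sub_apply, Pi.smul_apply, smul_eq_mul, Real.norm_eq_abs]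
  obtain h | h := realEntries_one_eq_zero_or_one i
  · simp [h]
  · simpa only [h, mul_one] using abs_sub_clamp_le
      ((norm_le_pi_norm (realEntries p) i).trans ((norm_realEntries_le p).trans hp)) r

variable [CompactSpace X]

/-- Truncating a scalar at `±‖a‖` brings it closer to `a`, so the infimum runs over a compact
interval. -/
theorem exists_enorm_realEntries_sub_smul_one_le_distScalars (a : C(X, MatrixSum m)) :
    ∃ r : ℝ, |r| ≤ ‖a‖ ∧ ∀ x, ‖realEntries (a x - r • 1)‖ₑ ≤ distScalars X m a := by
  set F : ℝ → ℝ≥0∞ := fun r => ⨆ x, ‖realEntries (a x - r • 1)‖ₑ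
  have hF_lsc : LowerSemicontinuous F := lowerSemicontinuous_iSup fun x =>
    (realEntries.continuous.comp (by fun_prop)).enorm.lowerSemicontinuous
  obtain ⟨s, hs, hmin⟩ := (hF_lsc.lowerSemicontinuousOn _).exists_isMinOn
    (Set.nonempty_Icc.2 (neg_le_self (norm_nonneg a))) isCompact_Icc
  refine ⟨s, abs_le.2 hs, fun x => (le_iSup (fun x => ‖realEntries (a x - s • 1)‖ₑ) x).trans
    (le_distScalars fun r => ?_)⟩
  have clamp_mem : max (-‖a‖) (min ‖a‖ r) ∈ Set.Icc (-‖a‖) ‖a‖ :=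
    ⟨le_max_left _ _, max_le (neg_le_self (norm_nonneg a)) (min_le_left _ _)⟩
  exact (hmin clamp_mem).trans (iSup_mono fun x =>
    enorm_le_iff_norm_le.2 (norm_realEntries_sub_clamp_le (a.norm_coe_le_norm x) r))

theorem distScalars_add_le (a b : C(X, MatrixSum m)) :
    distScalars X m (a + b) ≤ distScalars X m a + distScalars X m b := by
  obtain ⟨r, -, hr⟩ := exists_enorm_realEntries_sub_smul_one_le_distScalars a
  obtain ⟨s, -, hs⟩ := exists_enorm_realEntries_sub_smul_one_le_distScalars b
  refine distScalars_le (r + s) fun x => ?_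
  rw [ContinuousMap.add_apply, add_smul, add_sub_add_comm, map_add]
  exact (enorm_add_le _ _).trans (add_le_add (hr x) (hs x))

theorem distScalars_smul_le (t : ℝ) (a : C(X, MatrixSum m)) :
    distScalars X m (t • a) ≤ ‖t‖ₑ * distScalars X m a := by
  obtain ⟨r, -, hr⟩ := exists_enorm_realEntries_sub_smul_one_le_distScalars a
  refine distScalars_le (t * r) fun x => ?_
  rw [ContinuousMap.smul_apply, mul_smul, ← smul_sub, map_smul, enorm_smul]
  gcongr
  exact hr x

theorem distScalars_eq_zero_iff {a : C(X, MatrixSum m)} :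
    distScalars X m a = 0 ↔ ∃ r : ℝ, a = r • 1 := by
  constructor
  · intro h
    obtain ⟨r, -, hr⟩ := exists_enorm_realEntries_sub_smul_one_le_distScalars a
    refine ⟨r, ContinuousMap.ext fun x => ?_⟩
    have := hr x
    rwa [h, nonpos_iff_eq_zero, enorm_eq_zero, map_eq_zero_iff _ realEntries.injective,
      sub_eq_zero] at this
  · rintro ⟨r, rfl⟩
    exact le_antisymm (distScalars_le r fun x => by simp) zero_le

theorem distScalars_le_enorm (a : C(X, MatrixSum m)) : distScalars X m a ≤ ‖a‖ₑ := by
  refine distScalars_le 0 fun x => ?_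
  rw [zero_smul, sub_zero]
  exact (enorm_realEntries_le _).trans (enorm_le_iff_norm_le.2 (a.norm_coe_le_norm x))

theorem continuous_distScalars : Continuous (distScalars X m) := by
  refine continuous_of_le_add_edist 1 (by simp) fun a b => ?_
  rw [one_mul, edist_eq_enorm_sub]
  calc distScalars X m a = distScalars X m (b + (a - b)) := by rw [add_sub_cancel]
    _ ≤ distScalars X m b + distScalars X m (a - b) := distScalars_add_le _ _
    _ ≤ distScalars X m b + ‖a - b‖ₑ := by gcongr; exact distScalars_le_enorm _

variable (X m) in
/-- The seminorm `L_X` of the paper, on all of `C(X, 𝔄)`: its restriction to the self-adjoint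
elements is the Lip-norm of `homogeneous X m`. -/
noncomputable def homogeneousLip (a : C(X, MatrixSum m)) : ℝ≥0∞ :=
  max (lipConst X m a) (distScalars X m a)

theorem homogeneousLip_add_le (a b : C(X, MatrixSum m)) :
    homogeneousLip X m (a + b) ≤ homogeneousLip X m a + homogeneousLip X m b :=
  max_le ((lipConst_add_le a b).trans (add_le_add (le_max_left _ _) (le_max_left _ _)))
    ((distScalars_add_le a b).trans (add_le_add (le_max_right _ _) (le_max_right _ _)))

theorem homogeneousLip_smul (t : ℝ) (a : C(X, MatrixSum m)) :
    homogeneousLip X m (t • a) = ‖t‖ₑ * homogeneousLip X m a := by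
  refine eq_enorm_mul_of_smul_le (N := homogeneousLip X m) (fun t a => max_le ?_ ?_) t a
  · exact (lipConst_smul_le t a).trans (by gcongr; exact le_max_left _ _)
  · exact (distScalars_smul_le t a).trans (by gcongr; exact le_max_right _ _)

theorem homogeneousLip_eq_zero_iff {a : C(X, MatrixSum m)} :
    homogeneousLip X m a = 0 ↔ ∃ r : ℝ, a = r • 1 := by
  rw [homogeneousLip, max_eq_zero, distScalars_eq_zero_iff, and_iff_right_iff_imp]
  rintro ⟨r, rfl⟩
  exact lipConst_smul_one r

theorem lowerSemicontinuous_homogeneousLip : LowerSemicontinuous (homogeneousLip X m) :=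
  lowerSemicontinuous_lipConst.sup continuous_distScalars.lowerSemicontinuous

end Seminorm

section Leibniz

variable {n : ℕ} {m : Fin (n + 1) → ℕ}
  {B : MatrixSum m →ₗ[ℝ] MatrixSum m →ₗ[ℝ] MatrixSum m}

theorem enorm_realEntries_bilin_sub_le (hB : ∀ p q, ‖B p q‖ ≤ ‖p‖ * ‖q‖)
    (p p' q q' : MatrixSum m) :
    ‖realEntries (B p q - B p' q')‖ₑ ≤ ENNReal.ofReal (√2 * maxSize m) *
      (‖p‖ₑ * ‖realEntries (q - q')‖ₑ + ‖q'‖ₑ * ‖realEntries (p - p')‖ₑ) := by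
  have enorm_bilin_le (p q : MatrixSum m) : ‖B p q‖ₑ ≤ ‖p‖ₑ * ‖q‖ₑ := by
    simp only [← ofReal_norm, ← ENNReal.ofReal_mul (norm_nonneg p)]
    exact ENNReal.ofReal_le_ofReal (hB p q)
  have split : B p q - B p' q' = B p (q - q') + B (p - p') q' := by
    rw [map_sub, map_sub, LinearMap.sub_apply]
    abel
  set C := ENNReal.ofReal (√2 * maxSize m)
  calc ‖realEntries (B p q - B p' q')‖ₑ
      ≤ ‖B p (q - q') + B (p - p') q'‖ₑ := split ▸ enorm_realEntries_le _
    _ ≤ ‖p‖ₑ * ‖q - q'‖ₑ + ‖p - p'‖ₑ * ‖q'‖ₑ :=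
        (enorm_add_le _ _).trans (add_le_add (enorm_bilin_le _ _) (enorm_bilin_le _ _))
    _ ≤ ‖p‖ₑ * (C * ‖realEntries (q - q')‖ₑ) + (C * ‖realEntries (p - p')‖ₑ) * ‖q'‖ₑ := by
        gcongr <;> exact enorm_le_mul_enorm_realEntries _
    _ = C * (‖p‖ₑ * ‖realEntries (q - q')‖ₑ + ‖q'‖ₑ * ‖realEntries (p - p')‖ₑ) := by ring

theorem norm_one_matrixSum_le : ‖(1 : MatrixSum m)‖ ≤ 1 := by
  nontriviality MatrixSum m
  exact norm_one.le

variable {X : Type u} [MetricSpace X] [CompactSpace X] {a b c : C(X, MatrixSum m)}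

theorem lipConst_bilin_le (hB : ∀ p q, ‖B p q‖ ≤ ‖p‖ * ‖q‖)
    (hc : ∀ x, c x = B (a x) (b x)) :
    lipConst X m c ≤ ENNReal.ofReal (√2 * maxSize m) *
      (‖a‖ₑ * lipConst X m b + ‖b‖ₑ * lipConst X m a) := by
  refine lipConst_le_iff.2 fun x y => ?_
  rw [hc, hc]
  calc _ ≤ ENNReal.ofReal (√2 * maxSize m) *
          (‖a x‖ₑ * ‖realEntries (b x - b y)‖ₑ + ‖b y‖ₑ * ‖realEntries (a x - a y)‖ₑ) :=
        enorm_realEntries_bilin_sub_le hB ..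
    _ ≤ ENNReal.ofReal (√2 * maxSize m) *
          (‖a‖ₑ * (lipConst X m b * edist x y) + ‖b‖ₑ * (lipConst X m a * edist x y)) := by
        gcongr
        · exact enorm_le_iff_norm_le.2 (a.norm_coe_le_norm x)
        · exact enorm_realEntries_sub_le b x y
        · exact enorm_le_iff_norm_le.2 (b.norm_coe_le_norm y)
        · exact enorm_realEntries_sub_le a x y
    _ = _ := by ring

theorem distScalars_bilin_le (hB : ∀ p q, ‖B p q‖ ≤ ‖p‖ * ‖q‖)
    (hB1 : ∃ t : ℝ, B 1 1 = t • 1) (hc : ∀ x, c x = B (a x) (b x)) :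
    distScalars X m c ≤ ENNReal.ofReal (√2 * maxSize m) *
      (‖a‖ₑ * distScalars X m b + ‖b‖ₑ * distScalars X m a) := by
  obtain ⟨t, ht⟩ := hB1
  obtain ⟨r, -, hr⟩ := exists_enorm_realEntries_sub_smul_one_le_distScalars a
  obtain ⟨s, hs_norm, hs⟩ := exists_enorm_realEntries_sub_smul_one_le_distScalars b
  have enorm_smul_one_le : ‖s • (1 : MatrixSum m)‖ₑ ≤ ‖b‖ₑ := by
    rw [enorm_le_iff_norm_le, norm_smul]
    exact (mul_le_of_le_one_right (norm_nonneg s) norm_one_matrixSum_le).trans hs_norm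
  refine distScalars_le (r * s * t) fun x => ?_
  have bilin_smul_one : (r * s * t) • (1 : MatrixSum m) = B (r • 1) (s • 1) := by
    rw [map_smul, map_smul, LinearMap.smul_apply, ht, smul_smul, smul_smul, mul_comm r s]
  rw [hc, bilin_smul_one]
  refine (enorm_realEntries_bilin_sub_le hB ..).trans ?_
  gcongr
  · exact enorm_le_iff_norm_le.2 (a.norm_coe_le_norm x)
  · exact hs x
  · exact hr x

theorem homogeneousLip_bilin_le (hB : ∀ p q, ‖B p q‖ ≤ ‖p‖ * ‖q‖)
    (hB1 : ∃ t : ℝ, B 1 1 = t • 1) (hc : ∀ x, c x = B (a x) (b x)) :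
    homogeneousLip X m c ≤ ENNReal.ofReal (√2 * maxSize m) *
      (‖a‖ₑ * homogeneousLip X m b + ‖b‖ₑ * homogeneousLip X m a) := by
  refine max_le ((lipConst_bilin_le hB hc).trans ?_) ((distScalars_bilin_le hB hB1 hc).trans ?_)
  · gcongr <;> exact le_max_left _ _
  · gcongr <;> exact le_max_right _ _

theorem norm_smul_add_le_of_norm_eq_half {E : Type*} [SeminormedAddCommGroup E] [NormedSpace ℂ E]
    {z : ℂ} (hz : ‖z‖ = 1 / 2) {p q : E} {c : ℝ} (hp : ‖p‖ ≤ c) (hq : ‖q‖ ≤ c) :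
    ‖z • (p + q)‖ ≤ c := by
  rw [norm_smul, hz]
  linarith [norm_add_le p q]

theorem homogeneousLip_jordan_le (a b : selfAdjoint C(X, MatrixSum m)) :
    homogeneousLip X m (jordan a b) ≤ ENNReal.ofReal (√2 * maxSize m) *
      (‖(a : C(X, MatrixSum m))‖ₑ * homogeneousLip X m b +
        ‖(b : C(X, MatrixSum m))‖ₑ * homogeneousLip X m a) := by
  let M := LinearMap.mul ℝ (MatrixSum m)
  refine homogeneousLip_bilin_le (B := (2 : ℂ)⁻¹ • (M + M.flip)) (fun p q => ?_) ⟨1, ?_⟩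
    fun x => rfl
  · exact norm_smul_add_le_of_norm_eq_half (by simp) (norm_mul_le p q)
      ((norm_mul_le q p).trans_eq (mul_comm _ _))
  · change (2 : ℂ)⁻¹ • ((1 : MatrixSum m) * 1 + 1 * 1) = (1 : ℝ) • 1
    rw [one_mul, ← two_smul ℂ, inv_smul_smul₀ two_ne_zero, one_smul]

theorem homogeneousLip_lie_le (a b : selfAdjoint C(X, MatrixSum m)) :
    homogeneousLip X m (lie a b) ≤ ENNReal.ofReal (√2 * maxSize m) *
      (‖(a : C(X, MatrixSum m))‖ₑ * homogeneousLip X m b +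
        ‖(b : C(X, MatrixSum m))‖ₑ * homogeneousLip X m a) := by
  let M := LinearMap.mul ℝ (MatrixSum m)
  refine homogeneousLip_bilin_le (B := (2 * Complex.I)⁻¹ • (M - M.flip)) (fun p q => ?_) ⟨0, ?_⟩
    fun x => rfl
  · change ‖(2 * Complex.I)⁻¹ • (p * q - q * p)‖ ≤ ‖p‖ * ‖q‖
    rw [sub_eq_add_neg]
    exact norm_smul_add_le_of_norm_eq_half (by simp) (norm_mul_le p q)
      ((norm_neg _).trans_le ((norm_mul_le q p).trans_eq (mul_comm _ _)))
  · change (2 * Complex.I)⁻¹ • ((1 : MatrixSum m) * 1 - 1 * 1) = (0 : ℝ) • 1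
    rw [sub_self, smul_zero, zero_smul]

end Leibniz

section LipschitzFunctions

theorem dense_setOf_lipschitzWith {X : Type*} [MetricSpace X] [CompactSpace X] :
    Dense {f : C(X, ℝ) | ∃ K, LipschitzWith K f} := by
  refine dense_iff_closure_eq.2
    (ContinuousMap.sublattice_closure_eq_top _ ⟨0, 0, .const 0⟩ ?_ ?_ ?_)
  · rintro f ⟨K, hf⟩ g ⟨K', hg⟩
    exact ⟨max K K', hf.min hg⟩
  · rintro f ⟨K, hf⟩ g ⟨K', hg⟩
    exact ⟨max K K', hf.max hg⟩
  · intro v x y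
    let c := (v y - v x) / dist x y
    have hc : LipschitzWith ‖c‖₊ fun z => v x + c * dist x z := by
      simpa using (LipschitzWith.const (v x)).add
        ((lipschitzWith_smul c).comp (LipschitzWith.dist_right x))
    refine ⟨⟨_, hc.continuous⟩, ⟨_, hc⟩, by simp, ?_⟩
    obtain rfl | hxy := eq_or_ne x y
    · simp
    · simp [c, div_mul_cancel₀ _ (dist_ne_zero.2 hxy)]

theorem totallyBounded_setOf_lipschitzWith {X E : Type*} [PseudoMetricSpace X] [CompactSpace X]
    [NormedAddCommGroup E] [ProperSpace E] (K : ℝ≥0) (R : ℝ) :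
    TotallyBounded {f : C(X, E) | LipschitzWith K f ∧ ∀ x, ‖f x‖ ≤ R} := by
  let T : Set (BoundedContinuousFunction X E) := {f | LipschitzWith K f ∧ ∀ x, ‖f x‖ ≤ R}
  have isCompact_closure : IsCompact (closure T) :=
    BoundedContinuousFunction.arzela_ascoli (Metric.closedBall 0 R) (isCompact_closedBall 0 R) T
      (fun f x hf => by simpa using hf.2 x)
      (LipschitzWith.uniformEquicontinuous _ K fun f => f.2.1).equicontinuous
  exact totallyBounded_preimage
    (ContinuousMap.isometryEquivBoundedOfCompact X E).isometry.isUniformInducing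
    (isCompact_closure.totallyBounded.subset subset_closure)

end LipschitzFunctions

section LipNorm

variable {X : Type u} [MetricSpace X] [CompactSpace X] {n : ℕ} {m : Fin (n + 1) → ℕ}

theorem dense_setOf_homogeneousLip_lt_top :
    Dense {a : C(X, MatrixSum m) | homogeneousLip X m a < ∞} := by
  let Φ : (EntryIndex m ⊕ EntryIndex m → C(X, ℝ)) → C(X, MatrixSum m) := fun f =>
    ⟨fun x => realEntries.symm fun i => f i x, by fun_prop⟩
  have Φ_continuous : Continuous Φ := by
    refine ContinuousMap.continuous_of_continuous_uncurry _ (realEntries.symm.continuous.comp ?_)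
    fun_prop
  have Φ_surjective : Function.Surjective Φ := fun a =>
    ⟨fun i => ⟨fun x => realEntries (a x) i, by fun_prop⟩,
      ContinuousMap.ext fun x => realEntries.symm_apply_apply (a x)⟩
  refine (Φ_surjective.denseRange.dense_image Φ_continuous
    (dense_pi Set.univ fun _ _ => dense_setOf_lipschitzWith)).mono ?_
  rintro _ ⟨f, hf, rfl⟩
  choose K hK using fun i => hf i trivial
  have hΦ : LipschitzWith (Finset.univ.sup K) fun x => realEntries (Φ f x) := fun x y => by
    simp only [Φ, ContinuousMap.coe_mk, realEntries.apply_symm_apply]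
    exact edist_pi_le_iff.2 fun i => (hK i).weaken (Finset.le_sup (Finset.mem_univ i)) x y
  exact max_lt ((lipConst_le_coe_iff.2 hΦ).trans_lt ENNReal.coe_lt_top)
    ((distScalars_le_enorm _).trans_lt enorm_lt_top)

theorem homogeneousLip_star_le (a : C(X, MatrixSum m)) :
    homogeneousLip X m (star a) ≤ homogeneousLip X m a := by
  have enorm_star (p : MatrixSum m) : ‖realEntries (star p)‖ₑ = ‖realEntries p‖ₑ :=
    enorm_eq_iff_norm_eq.2 (norm_realEntries_star p)
  obtain ⟨r, -, hr⟩ := exists_enorm_realEntries_sub_smul_one_le_distScalars a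
  refine max_le_max (lipConst_le_iff.2 fun x y => ?_) (distScalars_le r fun x => ?_)
  · rw [ContinuousMap.star_apply, ContinuousMap.star_apply, ← star_sub, enorm_star]
    exact enorm_realEntries_sub_le a x y
  · have star_sub_smul_one : star a x - r • 1 = star (a x - r • 1) := by simp
    rw [star_sub_smul_one, enorm_star]
    exact hr x

theorem homogeneousLip_selfAdjointPart_le (a : C(X, MatrixSum m)) :
    homogeneousLip X m (selfAdjointPart ℝ a) ≤ homogeneousLip X m a := by
  rw [selfAdjointPart_apply_coe, homogeneousLip_smul]
  calc ‖(⅟2 : ℝ)‖ₑ * homogeneousLip X m (a + star a)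
      ≤ ‖(⅟2 : ℝ)‖ₑ * (homogeneousLip X m a + homogeneousLip X m a) := by
        gcongr
        exact (homogeneousLip_add_le a _).trans (by gcongr; exact homogeneousLip_star_le a)
    _ = homogeneousLip X m a := by
        rw [← two_mul, ← mul_assoc, invOf_eq_inv, enorm_inv two_ne_zero,
          Real.enorm_eq_ofReal two_pos.le, ENNReal.ofReal_ofNat,
          ENNReal.inv_mul_cancel two_ne_zero ENNReal.ofNat_ne_top, one_mul]

theorem dense_setOf_homogeneousLip_lt_top_selfAdjoint :
    Dense {a : selfAdjoint C(X, MatrixSum m) | homogeneousLip X m a < ∞} := by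
  have surjective : Function.Surjective (selfAdjointPart ℝ (A := C(X, MatrixSum m))) :=
    fun a => ⟨a, a.2.selfAdjointPart_apply ℝ⟩
  refine (surjective.denseRange.dense_image (continuous_selfAdjointPart ℝ _)
    dense_setOf_homogeneousLip_lt_top).mono ?_
  rintro _ ⟨a, ha, rfl⟩
  exact (homogeneousLip_selfAdjointPart_le a).trans_lt ha

theorem exists_sub_smul_one_lipschitzWith {a : C(X, MatrixSum m)} (ha : homogeneousLip X m a ≤ 1) :
    ∃ r : ℝ, a - r • 1 ∈ {f : C(X, MatrixSum m) |
      LipschitzWith (√2 * maxSize m).toNNReal f ∧ ∀ x, ‖f x‖ ≤ √2 * maxSize m} := by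
  obtain ⟨r, -, hr⟩ := exists_enorm_realEntries_sub_smul_one_le_distScalars a
  refine ⟨r, fun x y => ?_, fun x => ?_⟩
  · rw [edist_eq_enorm_sub]
    calc ‖(a - r • 1) x - (a - r • 1) y‖ₑ = ‖a x - a y‖ₑ := by simp
      _ ≤ ENNReal.ofReal (√2 * maxSize m) * ‖realEntries (a x - a y)‖ₑ :=
        enorm_le_mul_enorm_realEntries _
      _ ≤ ENNReal.ofReal (√2 * maxSize m) * edist x y := by
        gcongr
        simpa using lipConst_le_iff.1 ((le_max_left _ _).trans ha) x y
  · have norm_le_one : ‖realEntries (a x - r • 1)‖ ≤ 1 := by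
      rw [← norm_one (α := ℝ), ← enorm_le_iff_norm_le, enorm_one]
      exact (hr x).trans ((le_max_right _ _).trans ha)
    exact (norm_le_mul_norm_realEntries _).trans
      (mul_le_of_le_one_right (by positivity) norm_le_one)

theorem isLipNorm_homogeneous : IsLipNorm (homogeneous X m).lip := by
  have : ProperSpace (MatrixSum m) := FiniteDimensional.proper ℂ _
  exact isLipNorm_of_totallyBounded (A := C(X, MatrixSum m))
    (fun a b => homogeneousLip_add_le a.1 b.1) (fun t a => homogeneousLip_smul t a.1)
    (lowerSemicontinuous_homogeneousLip.comp continuous_subtype_val)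
    dense_setOf_homogeneousLip_lt_top_selfAdjoint
    (fun a => homogeneousLip_eq_zero_iff.trans (exists_congr fun t =>
      (Subtype.ext_iff (a1 := a) (a2 := t • 1)).symm))
    (totallyBounded_setOf_lipschitzWith _ _) (fun a ha => exists_sub_smul_one_lipschitzWith ha)

theorem isQuasiLeibnizLipNorm_homogeneous (hm : 0 < maxSize m) :
    IsQuasiLeibnizLipNorm (√2 * maxSize m) 0 (homogeneous X m).lip where
  toIsLipNorm := isLipNorm_homogeneous
  one_le := one_le_mul_of_one_le_of_one_le (by simp) (mod_cast hm)
  nonneg := le_rfl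
  leibniz a b _ _ := by
    rw [ENNReal.ofReal_zero, zero_mul, zero_mul, add_zero]
    exact max_le (homogeneousLip_jordan_le a b) (homogeneousLip_lie_le a b)

end LipNorm

section Propinquity

theorem exists_lipschitzWith_comp_eq_norm_sub_le {Y X ι : Type*} [MetricSpace Y]
    [PseudoMetricSpace X] [Fintype ι] {e : Y → X} (he : Isometry e) {K : ℝ≥0} {f : Y → ι → ℝ}
    (hf : LipschitzWith K f) {c : ι → ℝ} {R : ℝ} (hR : 0 ≤ R) (hfR : ∀ y, ‖f y - c‖ ≤ R) :
    ∃ g : X → ι → ℝ, LipschitzWith K g ∧ (∀ x, ‖g x - c‖ ≤ R) ∧ ∀ y, g (e y) = f y := by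
  have extend_apply (y : Y) : Function.extend e f 0 (e y) = f y := he.injective.extend_apply ..
  have lipschitzOnWith_extend : LipschitzOnWith K (Function.extend e f 0) (Set.range e) := by
    rintro _ ⟨y, rfl⟩ _ ⟨y', rfl⟩
    rw [extend_apply, extend_apply, he.edist_eq]
    exact hf y y'
  obtain ⟨g, hg, hgf⟩ := lipschitzOnWith_extend.extend_pi
  refine ⟨fun x i => max (c i - R) (min (c i + R) (g x i)), fun x x' => ?_, fun x => ?_,
    fun y => funext fun i => ?_⟩
  · exact edist_pi_le_iff.2 fun i =>
      (((LipschitzWith.eval i).comp hg |>.const_min _).const_max _ x x').trans_eq (by simp)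
  · refine (pi_norm_le_iff_of_nonneg hR).2 fun i => ?_
    simp only [Pi.sub_apply, Real.norm_eq_abs, abs_le]
    grind
  · have := (norm_le_pi_norm (f y - c) i).trans (hfR y)
    rw [Pi.sub_apply, Real.norm_eq_abs, abs_le] at this
    beta_reduce
    rw [← hgf ⟨y, rfl⟩, extend_apply, min_eq_right (by linarith), max_eq_right (by linarith)]

theorem nontrivial_matrixSum {n : ℕ} {m : Fin (n + 1) → ℕ} (hm : 0 < maxSize m) :
    Nontrivial (MatrixSum m) := by
  obtain ⟨l, -, hl⟩ := (Finset.lt_sup_iff (f := m)).1 hm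
  have : Nonempty (Fin (m l)) := ⟨⟨0, hl⟩⟩
  exact Pi.nontrivial_at l

variable {Y X Z : Type u} [MetricSpace Y] [MetricSpace X] [TopologicalSpace Z] [CompactSpace Z]
  {n : ℕ} {m : Fin (n + 1) → ℕ}

theorem homogeneousLip_comp_le {e : C(Y, X)} (he : LipschitzWith 1 e) (b : C(X, MatrixSum m)) :
    homogeneousLip Y m (b.comp e) ≤ homogeneousLip X m b := by
  refine max_le_max (lipConst_le_iff.2 fun y y' => ?_) ?_
  · refine (enorm_realEntries_sub_le b (e y) (e y')).trans ?_
    gcongr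
    simpa using he y y'
  · exact le_distScalars fun r => (distScalars_le r fun y =>
      le_iSup (fun x => ‖realEntries (b x - r • 1)‖ₑ) (e y))

theorem edist_comp_le (b : C(X, MatrixSum m)) {f g : C(Z, X)} {r : ℝ≥0∞}
    (h : ∀ z, edist (f z) (g z) ≤ r) :
    edist (b.comp f) (b.comp g) ≤
      ENNReal.ofReal (√2 * maxSize m) * (lipConst X m b * r) := by
  rw [ContinuousMap.edist_eq_iSup]
  refine iSup_le fun z => ?_
  rw [edist_eq_enorm_sub]
  refine (enorm_le_mul_enorm_realEntries _).trans ?_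
  gcongr
  exact (enorm_realEntries_sub_le b (f z) (g z)).trans (by gcongr; exact h z)

variable [CompactSpace Y] [CompactSpace X]

theorem exists_selfAdjoint_comp_eq_homogeneousLip_le {e : C(Y, X)} (he : Isometry e)
    (a : selfAdjoint C(Y, MatrixSum m)) {K : ℝ≥0} (ha : homogeneousLip Y m a ≤ K) :
    ∃ b : selfAdjoint C(X, MatrixSum m), homogeneousLip X m b ≤ K ∧
      (b : C(X, MatrixSum m)).comp e = a := by
  obtain ⟨r, -, hr⟩ := exists_enorm_realEntries_sub_smul_one_le_distScalars (a : C(Y, MatrixSum m))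
  have norm_sub_le (y : Y) :
      ‖realEntries ((a : C(Y, MatrixSum m)) y) - realEntries (r • (1 : MatrixSum m))‖ ≤ K := by
    rw [← map_sub]
    exact mod_cast (hr y).trans ((le_max_right _ _).trans ha)
  obtain ⟨g, hgK, hgr, hge⟩ := exists_lipschitzWith_comp_eq_norm_sub_le he
    (lipConst_le_coe_iff.1 ((le_max_left _ _).trans ha)) K.coe_nonneg norm_sub_le
  let b : C(X, MatrixSum m) :=
    ⟨fun x => realEntries.symm (g x), realEntries.symm.continuous.comp hgK.continuous⟩
  have realEntries_b (x : X) : realEntries (b x) = g x := realEntries.apply_symm_apply _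
  have b_comp : b.comp e = a := ContinuousMap.ext fun y =>
    realEntries.injective ((realEntries_b _).trans (hge y))
  refine ⟨selfAdjointPart ℝ b, (homogeneousLip_selfAdjointPart_le b).trans (max_le ?_ ?_), ?_⟩
  · exact lipConst_le_coe_iff.2 (by simpa only [realEntries_b] using hgK)
  · refine distScalars_le r fun x => ?_
    rw [map_sub, realEntries_b]
    exact mod_cast hgr x
  · calc _ = (selfAdjointPart ℝ (b.comp e) : C(Y, MatrixSum m)) := rfl
      _ = a := by rw [b_comp]; exact a.2.coe_selfAdjointPart_apply ℝ

/-- The bridge induced by a correspondence between `Y` and `X`, given as a compact space `Z` with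
surjections `p` and `q` onto `Y` and `X`: both algebras are pulled back to `C(Z, 𝔄)`, and the
pivot is the unit. -/
noncomputable def correspondenceBridge (hm : 0 < maxSize m) [Nonempty Z] {p : C(Z, Y)} {q : C(Z, X)}
    (hp : Function.Surjective p) (hq : Function.Surjective q) :
    Bridge (homogeneous Y m).carrier (homogeneous X m).carrier where
  space := C(Z, MatrixSum m)
  pivot := 1
  levelOne_nonempty := by
    have := nontrivial_matrixSum hm
    have : Nonempty (StateSpace C(Z, MatrixSum m)) := nonempty_stateSpace
    rw [levelOne_one]
    exact Set.univ_nonempty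
  left := ContinuousMap.compStarAlgHom' ℂ (MatrixSum m) p
  right := ContinuousMap.compStarAlgHom' ℂ (MatrixSum m) q
  left_injective _ _ h := (ContinuousMap.cancel_right hp).1 h
  right_injective _ _ h := (ContinuousMap.cancel_right hq).1 h

theorem length_correspondenceBridge_le (hm : 0 < maxSize m) [Nonempty Z] {p : C(Z, Y)}
    {q : C(Z, X)} (hp : Function.Surjective p) (hq : Function.Surjective q) {e : C(Y, X)}
    (he : Isometry e) {r : ℝ≥0∞} (hr : ∀ z, edist (e (p z)) (q z) ≤ r) :
    (correspondenceBridge hm hp hq).length ≤ ENNReal.ofReal (√2 * maxSize m) * r := by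
  have edist_le {b : C(X, MatrixSum m)} (hb : homogeneousLip X m b ≤ 1) :
      edist ((b.comp e).comp p) (b.comp q) ≤ ENNReal.ofReal (√2 * maxSize m) * r := by
    refine (edist_comp_le b (f := e.comp p) hr).trans ?_
    gcongr
    exact mul_le_of_le_one_left' ((le_max_left _ _).trans hb)
  have edist_pivot (a : C(Y, MatrixSum m)) (b : C(X, MatrixSum m)) :
      edist ((correspondenceBridge hm hp hq).left a * (correspondenceBridge hm hp hq).pivot)
        ((correspondenceBridge hm hp hq).pivot * (correspondenceBridge hm hp hq).right b) =
      edist (a.comp p) (b.comp q) := congrArg₂ edist (mul_one _) (one_mul _)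
  rw [Bridge.length, height_eq_zero_of_pivot_eq_one rfl, max_eq_left zero_le]
  refine Metric.hausdorffEDist_le_of_mem_edist ?_ ?_
  · rintro _ ⟨_, ⟨a, ha, rfl⟩, rfl⟩
    obtain ⟨b, hb, hba⟩ := exists_selfAdjoint_comp_eq_homogeneousLip_le he a (K := 1) ha
    exact ⟨_, ⟨b.1, ⟨b, hb, rfl⟩, rfl⟩, (edist_pivot a.1 b.1).trans_le (hba ▸ edist_le hb)⟩
  · rintro _ ⟨_, ⟨(b : selfAdjoint C(X, MatrixSum m)), hb, rfl⟩, rfl⟩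
    let a : selfAdjoint C(Y, MatrixSum m) :=
      ⟨(b : C(X, MatrixSum m)).comp e, congrArg (ContinuousMap.comp · e) b.2⟩
    refine ⟨_, ⟨a.1, ⟨a, (homogeneousLip_comp_le he.lipschitz b.1).trans hb, rfl⟩, rfl⟩, ?_⟩
    rw [edist_comm]
    exact (edist_pivot a.1 b.1).trans_le (edist_le hb)

theorem propinquity_homogeneous_le (hm : 0 < maxSize m) [Nonempty Y] {e : C(Y, X)}
    (he : Isometry e) {r : ℝ≥0∞} (hr : ∀ x, ∃ y, edist (e y) x ≤ r) :
    propinquity (homogeneous Y m) (homogeneous X m) ≤ ENNReal.ofReal (√2 * maxSize m) * r := by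
  let Z := {z : Y × X // edist (e z.1) z.2 ≤ r}
  have : CompactSpace Z := isCompact_iff_compactSpace.1
    (isClosed_le (f := fun z : Y × X => edist (e z.1) z.2) (by fun_prop)
      continuous_const).isCompact
  have : Nonempty Z := ⟨⟨(Classical.arbitrary Y, e (Classical.arbitrary Y)), by simp⟩⟩
  let p : C(Z, Y) := ⟨fun z => z.1.1, by fun_prop⟩
  let q : C(Z, X) := ⟨fun z => z.1.2, by fun_prop⟩
  have hp : Function.Surjective p := fun y => ⟨⟨(y, e y), by simp⟩, rfl⟩
  have hq : Function.Surjective q := fun x =>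
    let ⟨y, hy⟩ := hr x
    ⟨⟨(y, x), hy⟩, rfl⟩
  exact (iInf_le _ (Trek.single ⟨_, _, isQuasiLeibnizLipNorm_homogeneous hm⟩
    ⟨_, _, isQuasiLeibnizLipNorm_homogeneous hm⟩ (correspondenceBridge hm hp hq))).trans
    (length_correspondenceBridge_le hm hp hq he fun z => z.2)

theorem finiteDimensional_continuousMap {𝕜 S E : Type*} [DivisionRing 𝕜] [TopologicalSpace S]
    [Finite S] [TopologicalSpace E] [AddCommGroup E] [IsTopologicalAddGroup E] [Module 𝕜 E]
    [ContinuousConstSMul 𝕜 E] [FiniteDimensional 𝕜 E] : FiniteDimensional 𝕜 C(S, E) :=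
  .of_injective (ContinuousMap.coeFnLinearMap 𝕜) DFunLike.coe_injective

theorem exists_finset_edist_le {X : Type*} [PseudoEMetricSpace X] [CompactSpace X] {r : ℝ≥0}
    (hr : r ≠ 0) : ∃ S : Finset X, ∀ x, ∃ y : S, edist (y : X) x ≤ r := by
  obtain ⟨N, -, N_finite, N_cover⟩ := Metric.exists_finite_isCover_of_isCompact hr
    (isCompact_univ (X := X))
  refine ⟨N_finite.toFinset, fun x => ?_⟩
  obtain ⟨y, hy, hxy⟩ := N_cover (Set.mem_univ x)
  exact ⟨⟨y, N_finite.mem_toFinset.2 hy⟩, (edist_comm _ _).trans_le hxy⟩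

end Propinquity

end QuantumMetric

theorem mainTheorem6 {X : Type u} [MetricSpace X] [CompactSpace X] [Nonempty X]
    {n : ℕ} (m : Fin (n + 1) → ℕ) (hm : ∀ l, 0 < m l) :
    ∃ S : ℕ → Finset X,
      (∀ k, (S k).Nonempty) ∧
      (∀ k, FiniteDimensional ℂ (QuantumMetric.homogeneous (S k) m).carrier) ∧
      (∀ k, QuantumMetric.IsQuasiLeibnizLipNorm (√2 * QuantumMetric.maxSize m) 0
        (QuantumMetric.homogeneous (S k) m).lip) ∧
      QuantumMetric.IsQuasiLeibnizLipNorm (√2 * QuantumMetric.maxSize m) 0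
        (QuantumMetric.homogeneous X m).lip ∧
      Tendsto (fun k => QuantumMetric.propinquity (QuantumMetric.homogeneous (S k) m)
        (QuantumMetric.homogeneous X m)) atTop (𝓝 0) := by
  have maxSize_pos : 0 < QuantumMetric.maxSize m :=
    (hm 0).trans_le (Finset.le_sup (f := m) (Finset.mem_univ 0))
  obtain ⟨r, -, r_pos, tendsto_r⟩ := exists_seq_strictAnti_tendsto (0 : ℝ≥0)
  choose S hS using fun k => QuantumMetric.exists_finset_edist_le (X := X) (r_pos k).ne'
  have nonempty_S (k : ℕ) : Nonempty (S k) := ⟨(hS k (Classical.arbitrary X)).choose⟩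
  refine ⟨S, fun k => Finset.nonempty_coe_sort.1 (nonempty_S k),
    fun _ => QuantumMetric.finiteDimensional_continuousMap,
    fun _ => QuantumMetric.isQuasiLeibnizLipNorm_homogeneous maxSize_pos,
    QuantumMetric.isQuasiLeibnizLipNorm_homogeneous maxSize_pos, ?_⟩
  have tendsto_bound := ENNReal.Tendsto.const_mul (ENNReal.tendsto_coe.2 tendsto_r)
    (Or.inr (ENNReal.ofReal_ne_top (r := √2 * QuantumMetric.maxSize m)))
  rw [ENNReal.coe_zero, mul_zero] at tendsto_bound
  exact tendsto_of_tendsto_of_tendsto_of_le_of_le tendsto_const_nhds tendsto_bound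
    (fun _ => zero_le) fun k => QuantumMetric.propinquity_homogeneous_le maxSize_pos
      (e := ⟨Subtype.val, continuous_subtype_val⟩) isometry_subtype_coe (hS k)
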